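/- Let $n\ge 1$, $\mathcal V=\{1,\dots,n\}$, $\epsilon>0$, and let $\{\xi_i(t): i\in\mathcal V,\ t\ge 1\}$ be independent real random variables on a probability space with common mean $\mathbb E\,\xi_i(t)=C\in\mathbb R$ such that, for some real $\delta_1,\delta_2$, (i) $0<\delta_2-\delta_1\le\epsilon$ and $P\{\delta_1\le \xi_i(t)\le\delta_2\}=1$ for all $i\in\mathcal V$, $t\ge1$; (ii) there are constants $a\in\left(0,\frac{\delta_2-\delta_1}{2}\right)$ and $p\in(0,1)$ such that, for all $i\in\mathcal V$, $t\ge 1$, $$P\left\{\xi_i(t)\ge\tfrac{\delta_1+\delta_2}{2}+a\right\}\ge p\quad\text{and}\quad P\left\{\xi_i(t)\le\tfrac{\delta_1+\delta_2}{2}-a\right\}\ge p .$$ For an arbitrary deterministic initial state $x(0)\in\mathbb R^n$ define the noisy Hegselmann–Krause (HK) process by $$x_i(t+1)=\frac{1}{|\mathcal N_i(x(t))|}\sum_{j\in\mathcal N_i(x(t))}x_j(t)+\xi_i(t+1),\qquad \mathcal N_i(x(t))=\{j\in\mathcal V: |x_j(t)-x_i(t)|\le\epsilon\},$$ for $i\in\mathcal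 V$, $t\ge0$, and put $d_{\mathcal V}(t)=\max_{i,j\in\mathcal V}|x_i(t)-x_j(t)|$. Then almost surely the system reaches quasi-synchronization in finite time, that is, the random time $$T=\min\{t\ge 0: d_{\mathcal V}(t')\le\epsilon\ \text{for all } t'\ge t\}$$ (with $T=\infty$ if there is no such $t$) satisfies $P\{T<\infty\}=1$; moreover $$\limsup_{t\to\infty}d_{\mathcal V}(t)\le\delta_2-\delta_1\quad\text{almost surely.}$$ -/

import Mathlib

open MeasureTheory ProbabilityTheory Filter

noncomputable section

namespace HK

/-- The neighbor set `N_i(x) = {j : |x_j - x_i| ≤ ε}`. -/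
def neighbors {n : ℕ} (ε : ℝ) (x : Fin n → ℝ) (i : Fin n) : Finset (Fin n) :=
  Finset.univ.filter fun j => |x j - x i| ≤ ε

/-- The average of the opinions of the neighbors of agent `i`
(the neighbor set contains `i` when `ε ≥ 0`, so its cardinality is not zero). -/
def localMean {n : ℕ} (ε : ℝ) (x : Fin n → ℝ) (i : Fin n) : ℝ :=
  (∑ j ∈ neighbors ε x i, x j) / ((neighbors ε x i).card : ℝ)

/-- The noisy Hegselmann-Krause process
`x_i(t+1) = |N_i(x(t))|⁻¹ ∑_{j ∈ N_i(x(t))} x_j(t) + ξ_i(t+1)`, `x(0) = x₀`.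
Only the noises `ξ i t` with `t ≥ 1` are used. -/
def state {n : ℕ} {Ω : Type*} (ε : ℝ) (x₀ : Fin n → ℝ) (ξ : Fin n → ℕ → Ω → ℝ) (ω : Ω) :
    ℕ → Fin n → ℝ
  | 0 => x₀
  | t + 1 => fun i => localMean ε (state ε x₀ ξ ω t) i + ξ i (t + 1) ω

/-- The opinion diameter `max_{i,j} |x_i - x_j|`. -/
def diam {n : ℕ} (x : Fin n → ℝ) : ℝ :=
  ⨆ q : Fin n × Fin n, |x q.1 - x q.2|

/-- `d_V = limsup_{t → ∞} d_V(t)` along a trajectory, as an extended real number. -/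
def limsupDiam {n : ℕ} (x : ℕ → Fin n → ℝ) : EReal :=
  limsup (fun t => (diam (x t) : EReal)) atTop

/-- `T = min {t : d_V(t') ≤ ε for all t' ≥ t}` along a trajectory, equal to `⊤` (infinity) when
there is no such `t`. -/
def syncTime {n : ℕ} (ε : ℝ) (x : ℕ → Fin n → ℝ) : ℕ∞ :=
  sInf ((fun t : ℕ => (t : ℕ∞)) '' {t : ℕ | ∀ t' : ℕ, t ≤ t' → diam (x t') ≤ ε})

end HK

end

/-!
A state of diameter at most `ε` is absorbing: all local means coincide in it, so the next diameter
is at most the width `δ₂ - δ₁ ≤ ε` of the noise. Both claims therefore follow once the diameter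
almost surely drops to `ε` at some time. The state space is unbounded, so no fixed noise pattern
achieves this from every state; instead the agents are partitioned into classes, given by a
colouring `f`, which are merged one after the other. Initially every agent is a class of its own.

Consider partitions into at most `k + 1` classes of diameter at most `D`.
* If agents of two classes are neighbours, the two classes together have diameter at most `2 D + ε`,
  and there are only `k` classes left (`clustered_of_not_separated`).
* If the classes do not interact, every local mean stays in the hull of its class. Noise that
  points inwards, downwards on the upper half and upwards on the lower half of each class, reduces
  the diameters to at most `max (D - 2 a) (δ₂ - δ₁)` (`Inward.classDiam_add`). There are finitely many
  patterns of signs, and a given one has at every step a probability at least `p ^ n`, independently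
  of the past. By Lévy's conditional Borel-Cantelli lemma it almost surely follows infinitely many
  of infinitely many visits to the states in which it is needed (`IsNoise.ae_frequently_signs`).
* If the classes have diameter at most `ε`, they keep this property until two of them interact, and
  until then the average over each class changes by the averaged noise only. The difference of two
  such averages is then a martingale with bounded increments, because the noise has a common mean.
  It is bounded on one side, since a class cannot pass another one without interaction. But a
  martingale with bounded increments that is bounded on one side converges, whereas these increments
  are at least `2 a` infinitely often. So two of the classes interact eventually
  (`IsNoise.ae_not_bddBelow_classMean_sub`, `exists_not_separated`).

Hence if partitions into `k + 1` classes of some bounded diameter recur, either a single class of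
diameter at most `ε` is reached or partitions into `k` classes of another bounded diameter recur.
Induction on `k` concludes (`IsNoise.ae_exists_diam_le`).
-/

namespace HK

variable {n : ℕ}

/-! ### Local means -/

lemma self_mem_neighbors {ε : ℝ} (hε : 0 ≤ ε) (x : Fin n → ℝ) (i : Fin n) :
    i ∈ neighbors ε x i := by
  simp [neighbors, hε]

lemma le_average {s : Finset (Fin n)} (hs : s.Nonempty) {x : Fin n → ℝ} {c : ℝ}
    (h : ∀ j ∈ s, c ≤ x j) : c ≤ (∑ j ∈ s, x j) / (s.card : ℝ) := by
  have hc : (0 : ℝ) < s.card := by exact_mod_cast hs.card_pos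
  rw [le_div_iff₀ hc, mul_comm, ← nsmul_eq_mul]
  exact Finset.card_nsmul_le_sum _ _ _ h

lemma average_le {s : Finset (Fin n)} (hs : s.Nonempty) {x : Fin n → ℝ} {c : ℝ}
    (h : ∀ j ∈ s, x j ≤ c) : (∑ j ∈ s, x j) / (s.card : ℝ) ≤ c := by
  have hc : (0 : ℝ) < s.card := by exact_mod_cast hs.card_pos
  rw [div_le_iff₀ hc, mul_comm, ← nsmul_eq_mul]
  exact Finset.sum_le_card_nsmul _ _ _ h

lemma measurable_localMean (ε : ℝ) (i : Fin n) :
    Measurable fun x : Fin n → ℝ => localMean ε x i := by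
  have hset : ∀ j : Fin n, MeasurableSet {x : Fin n → ℝ | |x j - x i| ≤ ε} := fun j =>
    measurableSet_le (by fun_prop) measurable_const
  simp only [localMean, neighbors, Finset.sum_filter, Finset.card_filter, Nat.cast_sum,
    Nat.cast_ite, Nat.cast_one, Nat.cast_zero]
  exact (Finset.measurable_sum _ fun j _ =>
    Measurable.ite (hset j) (measurable_pi_apply j) measurable_const).div
    (Finset.measurable_sum _ fun j _ =>
      Measurable.ite (hset j) measurable_const measurable_const)

/-! ### Classes of agents -/

/-- The classes (fibres) of the colouring `f` have diameter at most `D` in the state `x`. -/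
def ClassDiam (f : Fin n → Fin n) (D : ℝ) (x : Fin n → ℝ) : Prop :=
  ∀ i j, f i = f j → |x i - x j| ≤ D

/-- In the state `x` no two agents of different classes of the colouring `f` are neighbours. -/
def Separated (ε : ℝ) (f : Fin n → Fin n) (x : Fin n → ℝ) : Prop :=
  ∀ i j, |x i - x j| ≤ ε → f i = f j

/-- The agents can be partitioned into at most `k` classes of diameter at most `D`. -/
def Clustered (k : ℕ) (D : ℝ) (x : Fin n → ℝ) : Prop :=
  ∃ f : Fin n → Fin n, (Finset.univ.image f).card ≤ k ∧ ClassDiam f D x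

/-- The average of `x` over the class of the agent `i`. -/
noncomputable def classMean (f : Fin n → Fin n) (x : Fin n → ℝ) (i : Fin n) : ℝ :=
  (∑ j with f j = f i, x j) / ((Finset.univ.filter fun j => f j = f i).card : ℝ)

lemma class_nonempty (f : Fin n → Fin n) (i : Fin n) :
    (Finset.univ.filter fun j => f j = f i).Nonempty :=
  ⟨i, by simp⟩

lemma classMean_add (f : Fin n → Fin n) (x y : Fin n → ℝ) (i : Fin n) :
    classMean f (fun j => x j + y j) i = classMean f x i + classMean f y i := by
  simp only [classMean, Finset.sum_add_distrib, add_div]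

lemma classMean_const (f : Fin n → Fin n) (c : ℝ) (i : Fin n) :
    classMean f (fun _ => c) i = c := by
  have hc : ((Finset.univ.filter fun j => f j = f i).card : ℝ) ≠ 0 := by
    exact_mod_cast (class_nonempty f i).card_pos.ne'
  simp only [classMean, Finset.sum_const, nsmul_eq_mul]
  field_simp

lemma classMean_congr {f : Fin n → Fin n} {i j : Fin n} (h : f i = f j) (x : Fin n → ℝ) :
    classMean f x i = classMean f x j := by
  simp only [classMean, h]

lemma classMean_classMean (f : Fin n → Fin n) (x : Fin n → ℝ) (i : Fin n) :
    classMean f (classMean f x) i = classMean f x i := by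
  conv_rhs => rw [← classMean_const f (classMean f x i) i]
  rw [classMean, classMean]
  congr 1
  exact Finset.sum_congr rfl fun j hj => classMean_congr (by simpa using hj) x

lemma ClassDiam.mono {f : Fin n → Fin n} {D D' : ℝ} {x : Fin n → ℝ} (h : ClassDiam f D x)
    (hD : D ≤ D') : ClassDiam f D' x :=
  fun i j hij => (h i j hij).trans hD

lemma Clustered.mono {k : ℕ} {D D' : ℝ} {x : Fin n → ℝ} (h : Clustered k D x)
    (hD : D ≤ D') : Clustered k D' x :=
  let ⟨f, hf, hx⟩ := h
  ⟨f, hf, hx.mono hD⟩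

lemma clustered_self (x : Fin n → ℝ) : Clustered n 0 x :=
  ⟨id, by simp, fun i j hij => by simp [show i = j from hij]⟩

/-- Two classes that contain a pair of neighbours can be merged into one. -/
lemma clustered_of_not_separated {ε D : ℝ} (hε : 0 ≤ ε) (hD : 0 ≤ D) {k : ℕ}
    {f : Fin n → Fin n} {x : Fin n → ℝ} (hf : (Finset.univ.image f).card ≤ k + 1)
    (hx : ClassDiam f D x) (hsep : ¬ Separated ε f x) : Clustered k (2 * D + ε) x := by
  simp only [Separated, not_forall] at hsep
  obtain ⟨i, j, hij, hne⟩ := hsep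
  refine ⟨fun l => if f l = f j then f i else f l, ?_, ?_⟩
  · have hsub : (Finset.univ.image fun l => if f l = f j then f i else f l) ⊆
        (Finset.univ.image f).erase (f j) := by
      intro c hc
      simp only [Finset.mem_image, Finset.mem_univ, true_and] at hc
      obtain ⟨l, rfl⟩ := hc
      rw [Finset.mem_erase]
      split_ifs with h
      · exact ⟨hne, by simp⟩
      · exact ⟨h, by simp⟩
    have h1 := Finset.card_le_card hsub
    rw [Finset.card_erase_of_mem (by simp)] at h1
    omega
  · intro l m hlm
    have key : ∀ l m, f l = f i → f m = f j → |x l - x m| ≤ 2 * D + ε := by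
      intro l m hl hm
      have h1 := hx l i hl
      have h2 := hx m j hm
      rw [abs_le] at *
      constructor <;> linarith
    dsimp only at hlm
    split_ifs at hlm with h1 h2 h2
    · exact (hx l m (h1.trans h2.symm)).trans (by linarith)
    · rw [abs_sub_comm]; exact key m l hlm.symm h1
    · exact key l m hlm h2
    · exact (hx l m hlm).trans (by linarith)

/-- As long as the classes do not interact, each local mean stays in the convex hull of its
class. -/
lemma Separated.classDiam_localMean {ε D : ℝ} (hε : 0 ≤ ε) {f : Fin n → Fin n}
    {x : Fin n → ℝ} (hsep : Separated ε f x) (hx : ClassDiam f D x) :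
    ClassDiam f D (localMean ε x) := by
  have key : ∀ i j, f i = f j → localMean ε x i - D ≤ localMean ε x j := by
    intro i j hij
    refine le_average ⟨j, self_mem_neighbors hε x j⟩ fun l hl => ?_
    rw [sub_le_iff_le_add]
    refine average_le ⟨i, self_mem_neighbors hε x i⟩ fun k hk => ?_
    simp only [neighbors, Finset.mem_filter, Finset.mem_univ, true_and] at hk hl
    have := hx k l (((hsep k i hk).trans hij).trans (hsep l j hl).symm)
    linarith [le_abs_self (x k - x l)]
  intro i j hij
  rw [abs_le]
  constructor
  · linarith [key j i hij.symm]
  · linarith [key i j hij]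

/-- If the classes are cliques of the neighbour graph that do not interact, every local mean is
the average over the class. -/
lemma Separated.localMean_eq {ε : ℝ} {f : Fin n → Fin n} {x : Fin n → ℝ}
    (hsep : Separated ε f x) (hx : ClassDiam f ε x) (i : Fin n) :
    localMean ε x i = classMean f x i := by
  have : neighbors ε x i = Finset.univ.filter fun j => f j = f i := by
    ext j
    simp only [neighbors, Finset.mem_filter, Finset.mem_univ, true_and]
    exact ⟨hsep j i, hx j i⟩
  simp only [localMean, classMean, this]

/-! ### Steering the classes -/

/-- The noise values of the prescribed sign: at least `c + a` for `true`, at most `c - a` for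
`false`. -/
def signHalfLine (c a : ℝ) (b : Bool) : Set ℝ :=
  if b then Set.Ici (c + a) else Set.Iic (c - a)

/-- The signs `σ` point, inside each class of diameter at most `D`, from the values `μ` towards
the centre of the class: `true` (upwards) on a lower part and `false` (downwards) on an upper part,
both of length at most `D / 2`. -/
def Inward (f : Fin n → Fin n) (D : ℝ) (σ : Fin n → Bool) (μ : Fin n → ℝ) : Prop :=
  ∀ i j, f i = f j → (σ i = σ j → |μ i - μ j| ≤ D / 2) ∧
    (σ i = true → σ j = false → μ i ≤ μ j)

lemma exists_inward {f : Fin n → Fin n} {D : ℝ} {μ : Fin n → ℝ} (hμ : ClassDiam f D μ) :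
    ∃ σ, Inward f D σ μ := by
  -- the top of each class determines the threshold `top - D / 2` between the two parts
  have hmax : ∀ i, ∃ m, f m = f i ∧ ∀ j, f j = f i → μ j ≤ μ m := fun i => by
    obtain ⟨m, hm, h⟩ := Finset.exists_max_image _ μ (class_nonempty f i)
    simp only [Finset.mem_filter, Finset.mem_univ, true_and] at hm h
    exact ⟨m, hm, h⟩
  choose m hm hmμ using hmax
  refine ⟨fun i => decide (μ i < μ (m i) - D / 2), fun i j hij => ?_⟩
  have h1 := hmμ i (m j) ((hm j).trans hij.symm)
  have h2 := hmμ j (m i) ((hm i).trans hij)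
  have h3 := hmμ i i rfl
  have h4 := hmμ j j rfl
  have h5 := (abs_le.1 (hμ (m i) i (hm i))).2
  have h6 := (abs_le.1 (hμ (m j) j (hm j))).2
  refine ⟨fun h => ?_, fun hi hj => ?_⟩
  · rw [decide_eq_decide] at h
    rw [abs_le]
    by_cases hi : μ i < μ (m i) - D / 2
    · have := h.1 hi
      constructor <;> linarith
    · have := mt h.2 hi
      constructor <;> linarith
  · simp only [decide_eq_true_eq, decide_eq_false_iff_not, not_lt] at hi hj
    linarith

/-- Noise of inward signs brings the diameters of the classes down by `2 * a`, unless they drop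
to the width `δ₂ - δ₁` of the noise. -/
lemma Inward.classDiam_add {f : Fin n → Fin n} {D δ₁ δ₂ a : ℝ} {σ : Fin n → Bool}
    {μ v : Fin n → ℝ} (hμ : ClassDiam f D μ) (hσ : Inward f D σ μ)
    (hv : ∀ i, δ₁ ≤ v i ∧ v i ≤ δ₂) (hs : ∀ i, v i ∈ signHalfLine ((δ₂ + δ₁) / 2) a (σ i)) :
    ClassDiam f (max (D - 2 * a) (δ₂ - δ₁)) fun i => μ i + v i := by
  have key : ∀ i j, f i = f j → μ i + v i - (μ j + v j) ≤ max (D - 2 * a) (δ₂ - δ₁) := by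
    intro i j hij
    have hi := hs i
    have hj := hs j
    have hμ' := (abs_le.1 (hμ i j hij)).2
    have h1 := hσ i j hij
    have hvi := hv i
    have hvj := hv j
    rw [le_max_iff]
    by_contra! hlt
    cases hsi : σ i <;> cases hsj : σ j <;>
      simp only [hsi, hsj, signHalfLine, if_true, Bool.false_eq_true, if_false, Set.mem_Ici,
        Set.mem_Iic, forall_const, false_imp_iff, true_and, and_true, reduceCtorEq] at hi hj h1
    · linarith [le_abs_self (μ i - μ j)]
    · linarith
    · linarith
    · linarith [le_abs_self (μ i - μ j)]
  intro i j hij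
  rw [abs_sub_le_iff]
  exact ⟨key i j hij, key j i hij.symm⟩

/-! ### The diameter and the order of the classes -/

lemma abs_sub_le_diam (x : Fin n → ℝ) (i j : Fin n) : |x i - x j| ≤ diam x :=
  le_ciSup (f := fun q : Fin n × Fin n => |x q.1 - x q.2|) (Set.finite_range _).bddAbove (i, j)

lemma diam_le [NeZero n] {x : Fin n → ℝ} {D : ℝ} (h : ∀ i j, |x i - x j| ≤ D) : diam x ≤ D :=
  ciSup_le fun q => h q.1 q.2

/-- A synchronized state stays synchronized, since all local means coincide in it. -/
lemma diam_localMean_add_le [NeZero n] {ε δ₁ δ₂ : ℝ} {x v : Fin n → ℝ} (hx : diam x ≤ ε)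
    (hv : ∀ i, δ₁ ≤ v i ∧ v i ≤ δ₂) : diam (fun i => localMean ε x i + v i) ≤ δ₂ - δ₁ := by
  have hnbr : ∀ i, neighbors ε x i = Finset.univ := fun i => by
    ext j
    simpa [neighbors] using (abs_sub_le_diam x j i).trans hx
  refine diam_le fun i j => ?_
  simp only [localMean, hnbr]
  rw [abs_le]
  constructor <;> linarith [(hv i).1, (hv i).2, (hv j).1, (hv j).2]

/-- Between two non-interacting cliques the order of the opinions of one pair of agents decides
that of all pairs, hence also that of the averages. -/
lemma Separated.le_classMean_sub {ε : ℝ} {f : Fin n → Fin n} {x : Fin n → ℝ}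
    (hsep : Separated ε f x) (hx : ClassDiam f ε x) {i j : Fin n} (hij : f i ≠ f j)
    (hlt : x j < x i) : ε ≤ classMean f x i - classMean f x j := by
  -- an agent of one class cannot lie between two agents of the other class
  have hgap : ∀ k l, f k ≠ f l → x l < x k → ε < x k - x l := by
    intro k l hkl hlt
    by_contra! hc
    exact hkl (hsep k l (abs_le.2 ⟨by linarith [abs_nonneg (x i - x i), hx i i rfl], hc⟩))
  have hall : ∀ k l, f k = f i → f l = f j → ε ≤ x k - x l := by
    intro k l hk hl
    have h1 := hgap i j hij hlt
    have h2 := hx k i hk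
    have h3 := hgap k j (hk ▸ hij) (by linarith [(abs_le.1 h2).1])
    have h4 := hx l j hl
    exact (hgap k l (by rw [hk, hl]; exact hij) (by linarith [(abs_le.1 h4).2])).le
  rw [le_sub_iff_add_le]
  refine le_average (class_nonempty f i) fun k hk => ?_
  rw [← le_sub_iff_add_le']
  refine average_le (class_nonempty f j) fun l hl => ?_
  simp only [Finset.mem_filter, Finset.mem_univ, true_and] at hk hl
  linarith [hall k l hk hl]

/-! ### Recurrence of independent events and divergence of sums of independent variables -/

section Recurrence

variable {Ω : Type*} {mΩ : MeasurableSpace Ω} {P : Measure Ω} [IsProbabilityMeasure P]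

/-- If `B t` is independent of the past `F t` and has probability at least `q > 0`, then almost
surely it occurs at infinitely many of the times at which `G t ∈ F t` occurs. -/
lemma ae_frequently_inter {F : Filtration ℕ mΩ} {N : ℕ → MeasurableSpace Ω}
    (hN : ∀ t, N t ≤ F (t + 1)) (hind : ∀ t, Indep (N t) (F t) P) {G B : ℕ → Set Ω}
    (hG : ∀ t, MeasurableSet[F t] (G t)) (hB : ∀ t, MeasurableSet[N t] (B t))
    {q : ℝ} (hq : 0 < q) (hqB : ∀ t, q ≤ P.real (B t)) :
    ∀ᵐ ω ∂P, (∃ᶠ t in atTop, ω ∈ G t) → ∃ᶠ t in atTop, ω ∈ G t ∧ ω ∈ B t := by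
  let s : ℕ → Set Ω := fun t => Nat.casesOn t ∅ fun k => G k ∩ B k
  have hs : ∀ t, MeasurableSet[F t] (s t) := by
    rintro (_ | k)
    · exact @MeasurableSet.empty _ (F 0)
    · exact (F.mono k.le_succ _ (hG k)).inter (hN k _ (hB k))
  have hcond : ∀ t, P[(s (t + 1)).indicator (1 : Ω → ℝ) | F t] =ᵐ[P]
      (G t).indicator fun _ => P.real (B t) := by
    intro t
    have hBm : MeasurableSet (B t) := F.le (t + 1) _ (hN t _ (hB t))
    have h1 : (s (t + 1)).indicator (1 : Ω → ℝ) = (G t).indicator ((B t).indicator 1) := by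
      rw [Set.indicator_indicator]
    have h2 := condExp_indicator (m := F t) (μ := P) (f := (B t).indicator (1 : Ω → ℝ))
      ((integrable_const (1 : ℝ)).indicator hBm) (hG t)
    have h3 : P[(B t).indicator (1 : Ω → ℝ) | F t] =ᵐ[P] fun _ => P.real (B t) := by
      have := condExp_indep_eq ((hN t).trans (F.le _)) (F.le t)
        ((stronglyMeasurable_one (α := Ω) (β := ℝ)).indicator (hB t)) (hind t)
      rwa [integral_indicator_one hBm] at this
    rw [h1]
    filter_upwards [h2, h3] with ω h2 h3
    rw [h2]
    simp only [Set.indicator, h3]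
  filter_upwards [ae_mem_limsup_atTop_iff P hs, ae_all_iff.2 hcond] with ω hlim hcondω hfreq
  have htend : Tendsto (fun m => ∑ k ∈ Finset.range m,
      (P[(s (k + 1)).indicator (1 : Ω → ℝ) | F k]) ω) atTop atTop := by
    simp only [hcondω]
    rw [← not_summable_iff_tendsto_nat_atTop_of_nonneg fun k =>
      Set.indicator_nonneg (fun _ _ => measureReal_nonneg) ω]
    intro hsum
    have hlt := hsum.tendsto_atTop_zero.eventually (gt_mem_nhds hq)
    obtain ⟨t, ht, htlt⟩ := (hfreq.and_eventually hlt).exists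
    rw [Set.indicator_of_mem ht] at htlt
    exact absurd (hqB t) (not_le.2 htlt)
  have hmem := hlim.2 htend
  rw [mem_limsup_iff_frequently_mem] at hmem
  rw [frequently_atTop] at hmem ⊢
  intro m
  obtain ⟨t, ht, hts⟩ := hmem (m + 1)
  obtain ⟨k, rfl⟩ : ∃ k, t = k + 1 := ⟨t - 1, by omega⟩
  exact ⟨k, by omega, hts⟩

/-- The partial sums of bounded centred independent variables are a martingale with bounded
increments. Such a martingale is bounded below only if it converges, which is impossible if its
increments exceed a fixed positive level infinitely often. -/
lemma ae_not_bddBelow_sum {F : Filtration ℕ mΩ} {N : ℕ → MeasurableSpace Ω}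
    (hN : ∀ t, N t ≤ F (t + 1)) (hind : ∀ t, Indep (N t) (F t) P) {g : ℕ → Ω → ℝ}
    (hg : ∀ t, Measurable[N t] (g t)) (hmean : ∀ t, ∫ ω, g t ω ∂P = 0) {R c : ℝ}
    (hR : ∀ t, ∀ᵐ ω ∂P, |g t ω| ≤ R) (hc : 0 < c)
    (hfreq : ∀ᵐ ω ∂P, ∃ᶠ t in atTop, c ≤ g t ω) :
    ∀ᵐ ω ∂P, ¬ BddBelow (Set.range fun t => ∑ s ∈ Finset.range t, g s ω) := by
  have hgF : ∀ t, Measurable[F (t + 1)] (g t) := fun t => (hg t).mono (hN t) le_rfl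
  have hint : ∀ t, Integrable (g t) P := fun t =>
    Integrable.of_bound ((hgF t).mono (F.le _) le_rfl).aestronglyMeasurable R (hR t)
  set S : ℕ → Ω → ℝ := fun t ω => ∑ s ∈ Finset.range t, g s ω with hS
  have hdiff : ∀ t ω, S (t + 1) ω - S t ω = g t ω := fun t ω => by
    simp [hS, Finset.sum_range_succ]
  have hmart : Martingale S F P := by
    refine martingale_of_condExp_sub_eq_zero_nat (fun t => ?_) (fun t => ?_) fun t => ?_
    · refine Measurable.stronglyMeasurable (Finset.measurable_sum _ fun s hs => ?_)
      exact (hgF s).mono (F.mono (by simpa using hs)) le_rfl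
    · exact integrable_finsetSum _ fun s _ => hint s
    · have h1 : S (t + 1) - S t = g t := funext fun ω => hdiff t ω
      have h2 := condExp_indep_eq ((hN t).trans (F.le _)) (F.le t)
        (hg t).stronglyMeasurable (hind t)
      rw [h1]
      filter_upwards [h2] with ω hω
      rw [hω, hmean t, Pi.zero_apply]
  have hbdd : ∀ᵐ ω ∂P, ∀ t, |S (t + 1) ω - S t ω| ≤ R.toNNReal := by
    filter_upwards [ae_all_iff.2 hR] with ω hω t
    rw [hdiff]
    exact (hω t).trans (Real.le_coe_toNNReal R)
  filter_upwards [hmart.bddAbove_range_iff_bddBelow_range hbdd,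
    hmart.submartingale.bddAbove_iff_exists_tendsto hbdd, hfreq] with ω h1 h2 h3 hbelow
  obtain ⟨l, hl⟩ := h2.1 (h1.2 hbelow)
  have h0 : Tendsto (fun t => S (t + 1) ω - S t ω) atTop (nhds 0) := by
    simpa using (hl.comp (tendsto_add_atTop_nat 1)).sub hl
  simp only [hdiff] at h0
  obtain ⟨t, ht, htc⟩ := (h3.and_eventually (h0.eventually (gt_mem_nhds hc))).exists
  exact absurd ht (not_le.2 htc)

end Recurrence

/-! ### The noise and its filtration -/

section Noise

variable {n : ℕ} {Ω : Type*}

/-- The σ-algebra generated by the noises `ξ i t` of all agents at the times `t ≥ 1` in `T`. -/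
abbrev noiseSigma (ξ : Fin n → ℕ → Ω → ℝ) (T : Set ℕ) : MeasurableSpace Ω :=
  ⨆ q ∈ {q : Fin n × {t : ℕ // 1 ≤ t} | (q.2 : ℕ) ∈ T},
    MeasurableSpace.comap (ξ q.1 (q.2 : ℕ)) inferInstance

lemma noiseSigma_mono (ξ : Fin n → ℕ → Ω → ℝ) {T T' : Set ℕ} (h : T ⊆ T') :
    noiseSigma ξ T ≤ noiseSigma ξ T' :=
  biSup_mono fun _ hq => h hq

lemma measurable_noiseSigma (ξ : Fin n → ℕ → Ω → ℝ) {T : Set ℕ} {t : ℕ} (ht : 1 ≤ t)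
    (hT : t ∈ T) (i : Fin n) : Measurable[noiseSigma ξ T] (ξ i t) := by
  refine Measurable.mono (comap_measurable (ξ i t)) ?_ le_rfl
  exact le_iSup₂_of_le (f := fun (q : Fin n × {t : ℕ // 1 ≤ t})
    (_ : q ∈ {q : Fin n × {t : ℕ // 1 ≤ t} | (q.2 : ℕ) ∈ T}) =>
      MeasurableSpace.comap (ξ q.1 (q.2 : ℕ)) inferInstance) (i, ⟨t, ht⟩) hT le_rfl

variable [mΩ : MeasurableSpace Ω]

/-- The assumptions on the noise: independent over agents and times `t ≥ 1`, with common mean `C`,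
values in `[δ₁, δ₂]`, and probability at least `p` to deviate from the centre of this interval by
at least `a` upwards, and likewise downwards. -/
structure IsNoise (P : Measure Ω) (ξ : Fin n → ℕ → Ω → ℝ) (C δ₁ δ₂ a p : ℝ) : Prop where
  measurable : ∀ (i : Fin n) (t : ℕ), 1 ≤ t → Measurable (ξ i t)
  indep : iIndepFun (fun q : Fin n × {t : ℕ // 1 ≤ t} => ξ q.1 (q.2 : ℕ)) P
  mean : ∀ (i : Fin n) (t : ℕ), 1 ≤ t → ∫ ω, ξ i t ω ∂P = C
  bounded : ∀ (i : Fin n) (t : ℕ), 1 ≤ t → ∀ᵐ ω ∂P, δ₁ ≤ ξ i t ω ∧ ξ i t ω ≤ δ₂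
  sign : ∀ (i : Fin n) (t : ℕ), 1 ≤ t → ∀ b,
    p ≤ P.real {ω | ξ i t ω ∈ signHalfLine ((δ₂ + δ₁) / 2) a b}

variable {P : Measure Ω} {ξ : Fin n → ℕ → Ω → ℝ} {C δ₁ δ₂ a p : ℝ}

lemma IsNoise.noiseSigma_le (h : IsNoise P ξ C δ₁ δ₂ a p) (T : Set ℕ) :
    noiseSigma ξ T ≤ mΩ :=
  iSup₂_le fun q _ => (h.measurable q.1 q.2 q.2.2).comap_le

/-- The filtration of the noise: at time `t`, the noises up to time `t` are known. -/
def IsNoise.filtration (h : IsNoise P ξ C δ₁ δ₂ a p) : Filtration ℕ mΩ where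
  seq t := noiseSigma ξ (Set.Iic t)
  mono' _ _ hst := noiseSigma_mono ξ (Set.Iic_subset_Iic.2 hst)
  le' _ := h.noiseSigma_le _

lemma IsNoise.noiseSigma_le_filtration (h : IsNoise P ξ C δ₁ δ₂ a p) (t : ℕ) :
    noiseSigma ξ {t + 1} ≤ h.filtration (t + 1) :=
  noiseSigma_mono ξ (by simp)

lemma IsNoise.indep_filtration (h : IsNoise P ξ C δ₁ δ₂ a p) (t : ℕ) :
    Indep (noiseSigma ξ {t + 1}) (h.filtration t) P := by
  refine indep_iSup_of_disjoint
    (S := {q : Fin n × {t : ℕ // 1 ≤ t} | (q.2 : ℕ) ∈ ({t + 1} : Set ℕ)})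
    (T := {q : Fin n × {t : ℕ // 1 ≤ t} | (q.2 : ℕ) ∈ Set.Iic t})
    (fun q => (h.measurable q.1 q.2 q.2.2).comap_le) h.indep.iIndep ?_
  rw [Set.disjoint_left]
  intro q hq hq'
  simp only [Set.mem_ofPred_eq, Set.mem_singleton_iff, Set.mem_Iic] at hq hq'
  omega

lemma IsNoise.ae_bounded (h : IsNoise P ξ C δ₁ δ₂ a p) :
    ∀ᵐ ω ∂P, ∀ t i, δ₁ ≤ ξ i (t + 1) ω ∧ ξ i (t + 1) ω ≤ δ₂ :=
  ae_all_iff.2 fun t => ae_all_iff.2 fun i => h.bounded i (t + 1) t.succ_pos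

lemma measurableSet_signHalfLine (c a : ℝ) (b : Bool) : MeasurableSet (signHalfLine c a b) := by
  cases b
  · exact measurableSet_Iic
  · exact measurableSet_Ici

lemma IsNoise.pow_le_measureReal_signs (h : IsNoise P ξ C δ₁ δ₂ a p) (hp : 0 ≤ p) (t : ℕ)
    (σ : Fin n → Bool) :
    p ^ n ≤ P.real {ω | ∀ i, ξ i (t + 1) ω ∈ signHalfLine ((δ₂ + δ₁) / 2) a (σ i)} := by
  have hind : iIndepFun (fun i : Fin n => ξ i (t + 1)) P :=
    h.indep.precomp (g := fun i : Fin n => (i, (⟨t + 1, t.succ_pos⟩ : {t : ℕ // 1 ≤ t})))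
      fun i j hij => (Prod.ext_iff.1 hij).1
  have hprod := hind.meas_iInter
    (s := fun i => ξ i (t + 1) ⁻¹' signHalfLine ((δ₂ + δ₁) / 2) a (σ i))
    fun i => ⟨_, measurableSet_signHalfLine _ _ _, rfl⟩
  have hset : {ω | ∀ i, ξ i (t + 1) ω ∈ signHalfLine ((δ₂ + δ₁) / 2) a (σ i)} =
      ⋂ i, ξ i (t + 1) ⁻¹' signHalfLine ((δ₂ + δ₁) / 2) a (σ i) := by
    ext ω
    simp
  rw [hset, measureReal_def, hprod, ENNReal.toReal_prod]
  calc p ^ n = ∏ _i : Fin n, p := by simp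
    _ ≤ _ := Finset.prod_le_prod (fun _ _ => hp) fun i _ => h.sign i (t + 1) t.succ_pos (σ i)

lemma IsNoise.measurable_state (h : IsNoise P ξ C δ₁ δ₂ a p) (ε : ℝ) (x₀ : Fin n → ℝ) (t : ℕ) :
    Measurable[h.filtration t] fun ω => state ε x₀ ξ ω t := by
  induction t with
  | zero => exact measurable_const
  | succ t ih =>
    refine (@measurable_pi_iff _ _ _ (h.filtration (t + 1)) _ _).2 fun i => ?_
    refine Measurable.add (m := h.filtration (t + 1)) ((measurable_localMean ε i).comp
      (ih.mono (h.filtration.mono t.le_succ) le_rfl)) ?_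
    exact measurable_noiseSigma ξ t.succ_pos (by simp) i

/-- If the state visits a measurable set infinitely often, then almost surely infinitely many of
these visits are followed by noise of any prescribed signs. -/
lemma IsNoise.ae_frequently_signs [IsProbabilityMeasure P] (h : IsNoise P ξ C δ₁ δ₂ a p)
    (hp : 0 < p) (ε : ℝ) (x₀ : Fin n → ℝ) {K : Set (Fin n → ℝ)} (hK : MeasurableSet K)
    (σ : Fin n → Bool) :
    ∀ᵐ ω ∂P, (∃ᶠ t in atTop, state ε x₀ ξ ω t ∈ K) → ∃ᶠ t in atTop, state ε x₀ ξ ω t ∈ K ∧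
      ∀ i, ξ i (t + 1) ω ∈ signHalfLine ((δ₂ + δ₁) / 2) a (σ i) := by
  refine ae_frequently_inter (G := fun t => {ω | state ε x₀ ξ ω t ∈ K})
    (B := fun t => {ω | ∀ i, ξ i (t + 1) ω ∈ signHalfLine ((δ₂ + δ₁) / 2) a (σ i)})
    h.noiseSigma_le_filtration h.indep_filtration
    (fun t => h.measurable_state ε x₀ t hK) (fun t => ?_) (pow_pos hp n)
    fun t => h.pow_le_measureReal_signs hp.le t σ
  rw [Set.ofPred_forall]
  exact MeasurableSet.iInter fun i =>
    measurable_noiseSigma ξ t.succ_pos (Set.mem_singleton _) i (measurableSet_signHalfLine _ _ _)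

/-- The difference of the averages of the noise over two distinct classes, summed over time, is
almost surely unbounded below. -/
lemma IsNoise.ae_not_bddBelow_classMean_sub [IsProbabilityMeasure P]
    (h : IsNoise P ξ C δ₁ δ₂ a p) (hp : 0 < p) (ha : 0 < a) {f : Fin n → Fin n} {i j : Fin n}
    (hij : f i ≠ f j) :
    ∀ᵐ ω ∂P, ¬ BddBelow (Set.range fun t => ∑ s ∈ Finset.range t,
      (classMean f (fun k => ξ k (s + 1) ω) i - classMean f (fun k => ξ k (s + 1) ω) j)) := by
  have hint : ∀ t k, Integrable (ξ k (t + 1)) P := fun t k => by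
    refine Integrable.of_bound (h.measurable k (t + 1) t.succ_pos).aestronglyMeasurable
      (max |δ₁| |δ₂|) ?_
    filter_upwards [h.bounded k (t + 1) t.succ_pos] with ω hω
    exact abs_le_max_abs_abs hω.1 hω.2
  have hintMean : ∀ t k, Integrable (fun ω => classMean f (fun l => ξ l (t + 1) ω) k) P :=
    fun t k => (integrable_finsetSum _ fun l _ => hint t l).div_const _
  have hmean : ∀ t k, ∫ ω, classMean f (fun l => ξ l (t + 1) ω) k ∂P = C := fun t k => by
    rw [← classMean_const f C k]
    simp only [classMean]
    rw [integral_div, integral_finsetSum _ fun l _ => hint t l]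
    simp only [h.mean _ (t + 1) t.succ_pos]
  have hmeas : ∀ t k, Measurable[noiseSigma ξ {t + 1}]
      fun ω => classMean f (fun l => ξ l (t + 1) ω) k := fun t k =>
    (Finset.measurable_sum _ fun l _ =>
      measurable_noiseSigma ξ t.succ_pos (Set.mem_singleton _) l).div_const _
  refine ae_not_bddBelow_sum (R := δ₂ - δ₁) (c := 2 * a) h.noiseSigma_le_filtration
    h.indep_filtration (fun t => (hmeas t i).sub (hmeas t j)) (fun t => ?_) (fun t => ?_)
    (by positivity) ?_
  · rw [integral_sub (hintMean t i) (hintMean t j), hmean, hmean, sub_self]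
  · filter_upwards [h.ae_bounded] with ω hω
    have hb : ∀ k, δ₁ ≤ classMean f (fun l => ξ l (t + 1) ω) k ∧
        classMean f (fun l => ξ l (t + 1) ω) k ≤ δ₂ := fun k =>
      ⟨le_average (class_nonempty f k) fun l _ => (hω t l).1,
        average_le (class_nonempty f k) fun l _ => (hω t l).2⟩
    rw [abs_le]
    constructor <;> linarith [(hb i).1, (hb i).2, (hb j).1, (hb j).2]
  · -- the increment is at least `2 * a` if the noise is up on the class of `i`, down elsewhere;
    -- such noise recurs along any trajectory, here the one with `ε = 0` and `x₀ = 0`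
    filter_upwards [h.ae_frequently_signs hp 0 0 MeasurableSet.univ
      fun k => decide (f k = f i)] with ω hω
    refine (hω (Frequently.of_forall fun _ => trivial)).mono fun t ⟨_, ht⟩ => ?_
    have h1 : (δ₂ + δ₁) / 2 + a ≤ classMean f (fun l => ξ l (t + 1) ω) i := by
      refine le_average (class_nonempty f i) fun l hl => ?_
      have hl' : f l = f i := by simpa using hl
      simpa [signHalfLine, hl'] using ht l
    have h2 : classMean f (fun l => ξ l (t + 1) ω) j ≤ (δ₂ + δ₁) / 2 - a := by
      refine average_le (class_nonempty f j) fun l hl => ?_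
      have hl' : f l = f j := by simpa using hl
      simpa [signHalfLine, hl', hij.symm] using ht l
    linarith

end Noise

/-! ### Merging of the classes and synchronization -/

section Merging

variable {n : ℕ} {Ω : Type*} {ε δ₁ δ₂ : ℝ} {x₀ : Fin n → ℝ} {ξ : Fin n → ℕ → Ω → ℝ} {ω : Ω}

/-- While the classes are non-interacting cliques, their averages are moved by the averaged noise
only, so the difference of two of them follows the corresponding sums of the noise. The ordering of
the classes bounds it, hence these sums, from one side. -/
lemma bddBelow_of_separated (hδε : δ₂ - δ₁ ≤ ε)
    (hω : ∀ t i, δ₁ ≤ ξ i (t + 1) ω ∧ ξ i (t + 1) ω ≤ δ₂) {f : Fin n → Fin n} {t₀ : ℕ}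
    (hsep : ∀ t, t₀ ≤ t → Separated ε f (state ε x₀ ξ ω t))
    (hx : ∀ t, t₀ ≤ t → ClassDiam f ε (state ε x₀ ξ ω t)) {i j : Fin n} (hij : f i ≠ f j)
    (hlt : state ε x₀ ξ ω t₀ j < state ε x₀ ξ ω t₀ i) :
    BddBelow (Set.range fun t => ∑ s ∈ Finset.range t,
      (classMean f (fun k => ξ k (s + 1) ω) i - classMean f (fun k => ξ k (s + 1) ω) j)) := by
  set x := state ε x₀ ξ ω
  set S : ℕ → ℝ := fun t => ∑ s ∈ Finset.range t,
    (classMean f (fun k => ξ k (s + 1) ω) i - classMean f (fun k => ξ k (s + 1) ω) j) with hS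
  have hstep : ∀ t, t₀ ≤ t → x (t + 1) = fun k => classMean f (x t) k + ξ k (t + 1) ω := by
    intro t ht
    funext k
    rw [← (hsep t ht).localMean_eq (hx t ht)]
    rfl
  have horder : ∀ t, t₀ ≤ t → x t j < x t i := by
    intro t ht
    induction t, ht using Nat.le_induction with
    | base => exact hlt
    | succ t ht ih =>
      have hgap := (hsep t ht).le_classMean_sub (hx t ht) hij ih
      by_contra! hle
      have hi := hω t i
      have hj := hω t j
      -- in the extremal case the opinions coincide, which separation forbids
      refine hij (hsep (t + 1) (ht.trans t.le_succ) i j ?_)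
      have heq : x (t + 1) i = x (t + 1) j := by
        refine le_antisymm hle ?_
        rw [hstep t ht]
        linarith
      rw [heq, sub_self, abs_zero]
      linarith
  have hmean : ∀ t k, t₀ ≤ t → classMean f (x (t + 1)) k =
      classMean f (x t) k + classMean f (fun k => ξ k (t + 1) ω) k := by
    intro t k ht
    rw [hstep t ht, classMean_add, classMean_classMean]
  have hdiff : ∀ t, t₀ ≤ t →
      classMean f (x t) i - classMean f (x t) j - S t =
        classMean f (x t₀) i - classMean f (x t₀) j - S t₀ := by
    intro t ht
    induction t, ht using Nat.le_induction with
    | base => rfl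
    | succ t ht ih =>
      rw [← ih, hmean t i ht, hmean t j ht, hS]
      simp only [Finset.sum_range_succ]
      ring
  have hlow : ∀ t, t₀ ≤ t → ε - (classMean f (x t₀) i - classMean f (x t₀) j - S t₀) ≤ S t :=
    fun t ht => by
      linarith [hdiff t ht, (hsep t ht).le_classMean_sub (hx t ht) hij (horder t ht)]
  exact (isBoundedUnder_of_eventually_ge (eventually_atTop.2 ⟨t₀, hlow⟩)).bddBelow_range

/-- Non-interacting cliques stay cliques until two of them interact. -/
lemma exists_not_separated (hδε : δ₂ - δ₁ ≤ ε)
    (hω : ∀ t i, δ₁ ≤ ξ i (t + 1) ω ∧ ξ i (t + 1) ω ≤ δ₂) {f : Fin n → Fin n}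
    (hunb : ∀ i j, f i ≠ f j → ¬ BddBelow (Set.range fun t => ∑ s ∈ Finset.range t,
      (classMean f (fun k => ξ k (s + 1) ω) i - classMean f (fun k => ξ k (s + 1) ω) j)))
    {t₀ : ℕ} (hx : ClassDiam f ε (state ε x₀ ξ ω t₀)) {i j : Fin n} (hij : f i ≠ f j) :
    ∃ t, t₀ ≤ t ∧ ClassDiam f ε (state ε x₀ ξ ω t) ∧ ¬ Separated ε f (state ε x₀ ξ ω t) := by
  by_contra! hcon
  have hdiam : ∀ t, t₀ ≤ t → ClassDiam f ε (state ε x₀ ξ ω t) := by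
    intro t ht
    induction t, ht using Nat.le_induction with
    | base => exact hx
    | succ t ht ih =>
      intro k l hkl
      have hk := (hcon t ht ih).localMean_eq ih k
      have hl := (hcon t ht ih).localMean_eq ih l
      simp only [state]
      rw [hk, hl, classMean_congr hkl, abs_le]
      have h1 := hω t k
      have h2 := hω t l
      constructor <;> linarith
  have hsep : ∀ t, t₀ ≤ t → Separated ε f (state ε x₀ ξ ω t) := fun t ht =>
    hcon t ht (hdiam t ht)
  rcases lt_trichotomy (state ε x₀ ξ ω t₀ j) (state ε x₀ ξ ω t₀ i) with hlt | heq | hlt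
  · exact hunb i j hij (bddBelow_of_separated hδε hω hsep hdiam hij hlt)
  · refine hij (hsep t₀ le_rfl i j ?_)
    rw [heq, sub_self, abs_zero]
    exact (abs_nonneg _).trans (hx i i rfl)
  · exact hunb j i hij.symm (bddBelow_of_separated hδε hω hsep hdiam hij.symm hlt)

/-- After the first synchronization the diameter never exceeds the width of the noise. -/
lemma diam_le_of_diam_le [NeZero n] (hδε : δ₂ - δ₁ ≤ ε)
    (hω : ∀ t i, δ₁ ≤ ξ i (t + 1) ω ∧ ξ i (t + 1) ω ≤ δ₂) {t₀ : ℕ}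
    (h : diam (state ε x₀ ξ ω t₀) ≤ ε) (t : ℕ) (ht : t₀ < t) :
    diam (state ε x₀ ξ ω t) ≤ δ₂ - δ₁ := by
  induction t, ht using Nat.le_induction with
  | base => exact diam_localMean_add_le h (hω t₀)
  | succ t _ ih => exact diam_localMean_add_le (ih.trans hδε) (hω t)

end Merging

section Synchronization

variable {n : ℕ} {Ω : Type*} [MeasurableSpace Ω] {P : Measure Ω} [IsProbabilityMeasure P]
  {ξ : Fin n → ℕ → Ω → ℝ} {ε C δ₁ δ₂ a p : ℝ}

lemma measurableSet_inward (ε D : ℝ) (f : Fin n → Fin n) (σ : Fin n → Bool) :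
    MeasurableSet {x : Fin n → ℝ | Separated ε f x ∧ ClassDiam f D x ∧
      Inward f D σ (localMean ε x)} := by
  have hloc := fun i : Fin n => measurable_localMean (n := n) ε i
  have habs : ∀ (i j : Fin n) (r : ℝ), MeasurableSet {x : Fin n → ℝ | |x i - x j| ≤ r} :=
    fun i j r => measurableSet_le (by fun_prop) measurable_const
  have hsep : MeasurableSet {x : Fin n → ℝ | Separated ε f x} := by
    simp only [Separated, Set.ofPred_forall]
    exact MeasurableSet.iInter fun i => MeasurableSet.iInter fun j =>
      (habs i j ε).imp (MeasurableSet.const _)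
  have hclass : MeasurableSet {x : Fin n → ℝ | ClassDiam f D x} := by
    simp only [ClassDiam, Set.ofPred_forall]
    exact MeasurableSet.iInter fun i => MeasurableSet.iInter fun j =>
      MeasurableSet.iInter fun _ => habs i j D
  suffices hin : MeasurableSet {x : Fin n → ℝ | Inward f D σ (localMean ε x)} from
    hsep.inter (hclass.inter hin)
  simp only [Inward, Set.ofPred_forall]
  refine MeasurableSet.iInter fun i => MeasurableSet.iInter fun j =>
    MeasurableSet.iInter fun _ => MeasurableSet.inter ?_ ?_
  · exact (MeasurableSet.const _).imp
      (measurableSet_le ((hloc i).sub (hloc j)).abs measurable_const)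
  · exact (MeasurableSet.const _).imp ((MeasurableSet.const _).imp
      (measurableSet_le (hloc i) (hloc j)))

/-- If the agents form infinitely often at most `k + 1` classes of diameter at most `D`, then almost
surely, infinitely often, either two classes can be merged or the noise brings the diameters down
by `2 * a`. -/
lemma IsNoise.ae_frequently_clustered_sub (h : IsNoise P ξ C δ₁ δ₂ a p) (hp : 0 < p)
    (hε : 0 ≤ ε) (x₀ : Fin n → ℝ) (k : ℕ) {D : ℝ} (hD : 0 ≤ D) :
    ∀ᵐ ω ∂P, (∃ᶠ t in atTop, Clustered (k + 1) D (state ε x₀ ξ ω t)) →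
      (∃ᶠ t in atTop, Clustered k (2 * D + ε) (state ε x₀ ξ ω t)) ∨
      ∃ᶠ t in atTop, Clustered (k + 1) (max (D - 2 * a) (δ₂ - δ₁)) (state ε x₀ ξ ω t) := by
  have hsteer := ae_all_iff.2 fun f : Fin n → Fin n => ae_all_iff.2 fun σ : Fin n → Bool =>
    h.ae_frequently_signs hp ε x₀ (measurableSet_inward ε D f σ) σ
  filter_upwards [hsteer, h.ae_bounded] with ω hsteer hω hfreq
  rw [or_iff_not_imp_left, not_frequently]
  intro hmerge
  -- finitely many colourings and sign patterns: one pair of them is met infinitely often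
  have hpair : ∃ᶠ t in atTop, ∃ f : Fin n → Fin n, ∃ σ : Fin n → Bool,
      (Finset.univ.image f).card ≤ k + 1 ∧ (Separated ε f (state ε x₀ ξ ω t) ∧
        ClassDiam f D (state ε x₀ ξ ω t) ∧ Inward f D σ (localMean ε (state ε x₀ ξ ω t))) := by
    refine (hfreq.and_eventually hmerge).mono fun t ⟨⟨f, hf, hx⟩, hnot⟩ => ?_
    have hsep : Separated ε f (state ε x₀ ξ ω t) := by
      by_contra hsep
      exact hnot (clustered_of_not_separated hε hD hf hx hsep)
    obtain ⟨σ, hσ⟩ := exists_inward (hsep.classDiam_localMean hε hx)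
    exact ⟨f, σ, hf, hsep, hx, hσ⟩
  obtain ⟨f, hpair⟩ := frequently_exists.1 hpair
  obtain ⟨σ, hpair⟩ := frequently_exists.1 hpair
  have hf := hpair.exists.choose_spec.1
  have hnext := hsteer f σ (hpair.mono fun t ht => ht.2)
  refine (tendsto_add_atTop_nat 1).frequently (hnext.mono fun t ht => ?_)
  obtain ⟨⟨hsep, hx, hσ⟩, hs⟩ := ht
  exact ⟨f, hf, hσ.classDiam_add (hsep.classDiam_localMean hε hx) (hω t) hs⟩

/-- Induction on the number `k` of classes and, for fixed `k`, on the number `m` in a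
bound `ε + 2 * a * m` on their diameters. -/
lemma IsNoise.ae_exists_diam_le [NeZero n] (h : IsNoise P ξ C δ₁ δ₂ a p) (hp : 0 < p)
    (ha : 0 < a) (hε : 0 ≤ ε) (hδε : δ₂ - δ₁ ≤ ε) (x₀ : Fin n → ℝ) (k : ℕ) (D : ℝ) :
    ∀ᵐ ω ∂P, (∃ᶠ t in atTop, Clustered k D (state ε x₀ ξ ω t)) →
      ∃ t, diam (state ε x₀ ξ ω t) ≤ ε := by
  induction k generalizing D with
  | zero =>
    refine ae_of_all _ fun ω hfreq => ?_
    obtain ⟨t, f, hf, -⟩ := hfreq.exists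
    rw [Nat.le_zero, Finset.card_eq_zero, Finset.image_eq_empty] at hf
    exact absurd hf Finset.univ_nonempty.ne_empty
  | succ k ih =>
    have hstep : ∀ m : ℕ, ∀ᵐ ω ∂P,
        (∃ᶠ t in atTop, Clustered (k + 1) (ε + 2 * a * m) (state ε x₀ ξ ω t)) →
          ∃ t, diam (state ε x₀ ξ ω t) ≤ ε := by
      intro m
      induction m with
      | zero =>
        have hunb := ae_all_iff.2 fun f : Fin n → Fin n => ae_all_iff.2 fun i =>
          ae_all_iff.2 fun j => ae_all_iff.2 fun hij : f i ≠ f j =>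
            h.ae_not_bddBelow_classMean_sub hp ha hij
        filter_upwards [ih (2 * ε + ε), hunb, h.ae_bounded] with ω ihω hunb hω hfreq
        by_contra hcon
        refine hcon (ihω (frequently_atTop.2 fun t₀ => ?_))
        obtain ⟨t₁, ht₁, f, hf, hx⟩ := frequently_atTop.1 hfreq t₀
        simp only [Nat.cast_zero, mul_zero, add_zero] at hx
        obtain ⟨i, j, hij⟩ : ∃ i j, f i ≠ f j := by
          by_contra! hone
          exact hcon ⟨t₁, diam_le fun i j => hx i j (hone i j)⟩
        obtain ⟨t, ht, hxt, hsep⟩ := exists_not_separated hδε hω (hunb f) hx hij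
        exact ⟨t, ht₁.trans ht, clustered_of_not_separated hε hε hf hxt hsep⟩
      | succ m ihm =>
        filter_upwards [ihm, ih (2 * (ε + 2 * a * (m + 1 : ℕ)) + ε),
          h.ae_frequently_clustered_sub hp hε x₀ k
            (D := ε + 2 * a * (m + 1 : ℕ)) (by positivity)] with ω ihm ih hsub hfreq
        rcases hsub hfreq with hmerge | hshrink
        · exact ih hmerge
        · refine ihm (hshrink.mono fun t ht => ht.mono (max_le ?_ ?_))
          · push_cast
            linarith
          · have : 0 ≤ 2 * a * (m : ℝ) := by positivity
            linarith
    obtain ⟨m, hm⟩ := exists_nat_ge ((D - ε) / (2 * a))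
    rw [div_le_iff₀ (by positivity)] at hm
    filter_upwards [hstep m] with ω hω hfreq
    exact hω (hfreq.mono fun t ht => ht.mono (by linarith))

end Synchronization

end HK

theorem mainTheorem2 {Ω : Type*} [MeasurableSpace Ω] (P : Measure Ω) [IsProbabilityMeasure P]
    (n : ℕ) (hn : 1 ≤ n) (ε : ℝ) (hε : 0 < ε)
    (ξ : Fin n → ℕ → Ω → ℝ)
    (hmeas : ∀ (i : Fin n) (t : ℕ), 1 ≤ t → Measurable (ξ i t))
    (hindep : iIndepFun (fun q : Fin n × {t : ℕ // 1 ≤ t} => ξ q.1 (q.2 : ℕ)) P)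
    (C : ℝ) (hmean : ∀ (i : Fin n) (t : ℕ), 1 ≤ t → ∫ ω, ξ i t ω ∂P = C)
    (δ₁ δ₂ : ℝ) (hδ : 0 < δ₂ - δ₁) (hδε : δ₂ - δ₁ ≤ ε)
    (hbdd : ∀ (i : Fin n) (t : ℕ), 1 ≤ t → P {ω | δ₁ ≤ ξ i t ω ∧ ξ i t ω ≤ δ₂} = 1)
    (a p : ℝ) (ha : 0 < a) (ha' : a < (δ₂ - δ₁) / 2) (hp : 0 < p) (hp' : p < 1)
    (hup : ∀ (i : Fin n) (t : ℕ), 1 ≤ t → p ≤ P.real {ω | (δ₂ + δ₁) / 2 + a ≤ ξ i t ω})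
    (hdown : ∀ (i : Fin n) (t : ℕ), 1 ≤ t → p ≤ P.real {ω | ξ i t ω ≤ (δ₂ + δ₁) / 2 - a})
    (x₀ : Fin n → ℝ) :
    (∀ᵐ ω ∂P, HK.syncTime ε (HK.state ε x₀ ξ ω) < ⊤) ∧
      (∀ᵐ ω ∂P, HK.limsupDiam (HK.state ε x₀ ξ ω) ≤ ((δ₂ - δ₁ : ℝ) : EReal)) := by
  have : NeZero n := ⟨by omega⟩
  have h : HK.IsNoise P ξ C δ₁ δ₂ a p := by
    refine ⟨hmeas, hindep, hmean, fun i t ht => ?_, fun i t ht b => ?_⟩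
    · have hset : MeasurableSet {ω | δ₁ ≤ ξ i t ω ∧ ξ i t ω ≤ δ₂} :=
        (measurableSet_le measurable_const (hmeas i t ht)).inter
          (measurableSet_le (hmeas i t ht) measurable_const)
      exact (mem_ae_iff_prob_eq_one hset).2 (hbdd i t ht)
    · cases b
      · exact hdown i t ht
      · exact hup i t ht
  have hsync : ∀ᵐ ω ∂P, ∃ t₀, ∀ t, t₀ ≤ t → HK.diam (HK.state ε x₀ ξ ω t) ≤ δ₂ - δ₁ := by
    filter_upwards [h.ae_exists_diam_le hp ha hε.le hδε x₀ n 0, h.ae_bounded] with ω hex hω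
    obtain ⟨t₀, ht₀⟩ := hex (Frequently.of_forall fun t => HK.clustered_self _)
    exact ⟨t₀ + 1, HK.diam_le_of_diam_le hδε hω ht₀⟩
  constructor
  · filter_upwards [hsync] with ω ⟨t₀, ht₀⟩
    have hle : HK.syncTime ε (HK.state ε x₀ ξ ω) ≤ t₀ :=
      sInf_le ⟨t₀, fun t ht => (ht₀ t ht).trans hδε, rfl⟩
    exact hle.trans_lt (ENat.natCast_lt_top t₀)
  · filter_upwards [hsync] with ω ⟨t₀, ht₀⟩
    refine limsup_le_of_le (by isBoundedDefault) (eventually_atTop.2 ⟨t₀, fun t ht => ?_⟩)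
    exact_mod_cast ht₀ t ht
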